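/- Let $G$ be a finite simple graph that is connected and cubic (every vertex has degree $3$), and suppose that $G$ is not isomorphic to the complete bipartite graph $K_{3,3}$. Then $\partial\Gamma(G)=4$. Here a proper $k$-coloring of $G$ is a surjective map $c:V(G)\to\{1,\ldots,k\}$ with $c(u)\neq c(v)$ for every edge $uv$; a vertex $v$ is a Grundy vertex of $c$ if for every color $j<c(v)$ it has a neighbor of color $j$; a partial Grundy $k$-coloring is a proper $k$-coloring in which every color class contains a Grundy vertex; and the partial Grundy number $\partial\Gamma(G)$ is the largest $k$ such that $G$ admits a partial Grundy $k$-coloring. -/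

import Mathlib

namespace SimpleGraph

/-- The vertex `v` is a Grundy vertex of the proper coloring `c`:
for every color smaller than that of `v`, the vertex `v` has a neighbor of that color.
The colors `1, …, k` are represented, in the same order, by the elements of `Fin k`. -/
def IsGrundyVertex {V : Type*} {G : SimpleGraph V} {k : ℕ} (c : G.Coloring (Fin k)) (v : V) :
    Prop :=
  ∀ j : Fin k, j < c v → ∃ w : V, G.Adj v w ∧ c w = j

/-- `c` is a partial Grundy `k`-coloring: a proper coloring, onto the `k` colors, such that
every color class contains a Grundy vertex. -/
def IsPartialGrundyColoring {V : Type*} {G : SimpleGraph V} {k : ℕ} (c : G.Coloring (Fin k)) :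
    Prop :=
  Function.Surjective c ∧ ∀ i : Fin k, ∃ v : V, c v = i ∧ IsGrundyVertex c v

/-- The partial Grundy number: the largest `k` such that `G` admits a partial Grundy
`k`-coloring. (For a finite graph the set of these `k` is bounded by the number of vertices.) -/
noncomputable def partialGrundyNumber {V : Type*} (G : SimpleGraph V) : ℕ :=
  sSup {k : ℕ | ∃ c : G.Coloring (Fin k), IsPartialGrundyColoring c}

/-- For a finite graph the set in the definition is bounded, so its supremum is not a default
value. -/
theorem bddAbove_partialGrundy {V : Type*} [Finite V] (G : SimpleGraph V) :
    BddAbove {k : ℕ | ∃ c : G.Coloring (Fin k), IsPartialGrundyColoring c} := by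
  refine ⟨Nat.card V, ?_⟩
  rintro k ⟨c, hc, -⟩
  simpa using Nat.card_le_card_of_surjective c hc

end SimpleGraph

/-! A Grundy vertex of the top color sees every smaller color, so degree 3 allows at most 4 colors.
For the converse it suffices to precolor a small set properly, including a Grundy vertex of each
color and its witnessing neighbors: a vertex of degree 3 always has one of four colors free, so the
precoloring extends greedily and the witnesses survive. `exists_isPartialGrundyColoring_of_sets`
packages this, with `A`, `B`, `C`, `D` colored 0, 1, 2, 3.

Such a precoloring is built near a triangle, near a pair of twins (distinct vertices with equal
neighborhoods), or, if there are neither, around an arbitrary edge. Only the twin case can fail, and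
there failure forces a closed copy of `K₃,₃`, which by connectedness is the whole graph. -/

namespace SimpleGraph

variable {V : Type*}

/-! ### Precolorings and the upper bound. -/

/-- A precoloring with colors in `Fin 4`, proper on a finite set, extends greedily to a proper
coloring of a graph that is regular of degree three. -/
theorem exists_coloring_extending [Fintype V] (G : SimpleGraph V) [DecidableRel G.Adj]
    (hG : G.IsRegularOfDegree 3) (S : Set V) (c : V → Fin 4)
    (hc : ∀ u ∈ S, ∀ v ∈ S, G.Adj u v → c u ≠ c v) :
    ∃ d : G.Coloring (Fin 4), ∀ v ∈ S, d v = c v := by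
  classical
  have key : ∀ T : Finset V, ∃ d : V → Fin 4, (∀ v ∈ S, d v = c v) ∧
      ∀ u, u ∈ S ∨ u ∈ T → ∀ v, v ∈ S ∨ v ∈ T → G.Adj u v → d u ≠ d v := by
    intro T
    induction T using Finset.induction_on with
    | empty => exact ⟨c, fun _ _ => rfl, by simpa using hc⟩
    | insert w T hw ih =>
      obtain ⟨d, hd, hT⟩ := ih
      by_cases hwS : w ∈ S
      · refine ⟨d, hd, fun u hu v hv => hT u ?_ v ?_⟩ <;> grind
      have hcard : ((G.neighborFinset w).image d).card < (Finset.univ : Finset (Fin 4)).card := by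
        refine Finset.card_image_le.trans_lt ?_
        rw [card_neighborFinset_eq_degree, hG w]
        decide
      obtain ⟨i, -, hi⟩ := Finset.exists_mem_notMem_of_card_lt_card hcard
      have hi' : ∀ v, G.Adj w v → d v ≠ i := fun v hv h =>
        hi (Finset.mem_image.2 ⟨v, (G.mem_neighborFinset w v).2 hv, h⟩)
      refine ⟨Function.update d w i, fun v hv => ?_, fun u hu v hv huv => ?_⟩
      · rw [Function.update_of_ne (by grind), hd v hv]
      · have hne := huv.ne
        have hvu := huv.symm
        by_cases hu' : u = w <;> by_cases hv' : v = w <;> grind [Function.update_apply]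
  obtain ⟨d, hd, hT⟩ := key Finset.univ
  exact ⟨Coloring.mk d fun {u v} h => hT u (by simp) v (by simp) h, hd⟩

/-- Four disjoint independent sets that serve as color classes around a Grundy vertex of each
color give a partial Grundy coloring of a cubic graph. -/
theorem exists_isPartialGrundyColoring_of_sets [Fintype V] (G : SimpleGraph V)
    [DecidableRel G.Adj] (hG : G.IsRegularOfDegree 3) {A B C D : Set V} {x y z : V}
    (hA : ∀ u ∈ A, ∀ v ∈ A, ¬ G.Adj u v) (hB : ∀ u ∈ B, ∀ v ∈ B, ¬ G.Adj u v)
    (hC : ∀ u ∈ C, ∀ v ∈ C, ¬ G.Adj u v) (hD : ∀ u ∈ D, ∀ v ∈ D, ¬ G.Adj u v)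
    (hAB : ∀ v ∈ A, v ∉ B) (hAC : ∀ v ∈ A, v ∉ C) (hAD : ∀ v ∈ A, v ∉ D)
    (hBC : ∀ v ∈ B, v ∉ C) (hBD : ∀ v ∈ B, v ∉ D) (hCD : ∀ v ∈ C, v ∉ D)
    (hx : x ∈ D) (hxA : ∃ v ∈ A, G.Adj x v) (hxB : ∃ v ∈ B, G.Adj x v)
    (hxC : ∃ v ∈ C, G.Adj x v)
    (hy : y ∈ C) (hyA : ∃ v ∈ A, G.Adj y v) (hyB : ∃ v ∈ B, G.Adj y v)
    (hz : z ∈ B) (hzA : ∃ v ∈ A, G.Adj z v) :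
    ∃ c : G.Coloring (Fin 4), IsPartialGrundyColoring c := by
  classical
  let f : V → Fin 4 := fun v => if v ∈ A then 0 else if v ∈ B then 1 else if v ∈ C then 2 else 3
  have fA : ∀ v ∈ A, f v = 0 := fun v hv => by simp [f, hv]
  have fB : ∀ v ∈ B, f v = 1 := fun v hv => by
    have : v ∉ A := fun h => hAB v h hv
    simp [f, hv, this]
  have fC : ∀ v ∈ C, f v = 2 := fun v hv => by
    have h1 : v ∉ A := fun h => hAC v h hv
    have h2 : v ∉ B := fun h => hBC v h hv
    simp [f, hv, h1, h2]
  have fD : ∀ v ∈ D, f v = 3 := fun v hv => by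
    have h1 : v ∉ A := fun h => hAD v h hv
    have h2 : v ∉ B := fun h => hBD v h hv
    have h3 : v ∉ C := fun h => hCD v h hv
    simp [f, h1, h2, h3]
  obtain ⟨c, hc⟩ := exists_coloring_extending G hG {v | v ∈ A ∨ v ∈ B ∨ v ∈ C ∨ v ∈ D} f (by
    rintro u (hu | hu | hu | hu) v (hv | hv | hv | hv) huv <;>
      first
      | exact absurd huv (hA u hu v hv)
      | exact absurd huv (hB u hu v hv)
      | exact absurd huv (hC u hu v hv)
      | exact absurd huv (hD u hu v hv)
      | simp [fA, fB, fC, fD, hu, hv])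
  have cA : ∀ v ∈ A, c v = 0 := fun v hv => (hc v (.inl hv)).trans (fA v hv)
  have cB : ∀ v ∈ B, c v = 1 := fun v hv => (hc v (.inr (.inl hv))).trans (fB v hv)
  have cC : ∀ v ∈ C, c v = 2 := fun v hv => (hc v (.inr (.inr (.inl hv)))).trans (fC v hv)
  have cD : ∀ v ∈ D, c v = 3 := fun v hv => (hc v (.inr (.inr (.inr hv)))).trans (fD v hv)
  obtain ⟨a, ha, hxa⟩ := hxA
  obtain ⟨b, hb, hxb⟩ := hxB
  obtain ⟨e, he, hxe⟩ := hxC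
  obtain ⟨p, hp, hyp⟩ := hyA
  obtain ⟨q, hq, hyq⟩ := hyB
  obtain ⟨r, hr, hzr⟩ := hzA
  have hgr : ∀ i : Fin 4, ∃ v : V, c v = i ∧ IsGrundyVertex c v := by
    intro i
    fin_cases i
    · exact ⟨a, cA a ha, fun j hj => by simp [cA a ha] at hj⟩
    · refine ⟨z, cB z hz, fun j hj => ?_⟩
      rw [cB z hz] at hj
      fin_cases j
      · exact ⟨r, hzr, cA r hr⟩
      all_goals exact absurd hj (by decide)
    · refine ⟨y, cC y hy, fun j hj => ?_⟩
      rw [cC y hy] at hj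
      fin_cases j
      · exact ⟨p, hyp, cA p hp⟩
      · exact ⟨q, hyq, cB q hq⟩
      all_goals exact absurd hj (by decide)
    · refine ⟨x, cD x hx, fun j hj => ?_⟩
      rw [cD x hx] at hj
      fin_cases j
      · exact ⟨a, hxa, cA a ha⟩
      · exact ⟨b, hxb, cB b hb⟩
      · exact ⟨e, hxe, cC e he⟩
      exact absurd hj (by decide)
  exact ⟨c, fun i => (hgr i).imp fun _ h => h.1, hgr⟩

/-- In a graph of maximum degree at most `d`, a partial Grundy coloring has at most `d + 1`
colors. -/
theorem IsPartialGrundyColoring.le_succ_degree [Fintype V] {G : SimpleGraph V}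
    [DecidableRel G.Adj] {d k : ℕ} (hG : ∀ v, G.degree v ≤ d) {c : G.Coloring (Fin k)}
    (hc : IsPartialGrundyColoring c) : k ≤ d + 1 := by
  classical
  rcases k with _ | k
  · omega
  obtain ⟨v, hv, hgr⟩ := hc.2 (Fin.last k)
  have hsub : (Finset.univ : Finset (Fin k)).map Fin.castSuccEmb ⊆
      (G.neighborFinset v).image c := by
    intro j hj
    obtain ⟨i, -, rfl⟩ := Finset.mem_map.1 hj
    obtain ⟨w, hw, hwj⟩ := hgr (Fin.castSucc i) (hv ▸ Fin.castSucc_lt_last i)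
    exact Finset.mem_image.2 ⟨w, (G.mem_neighborFinset v w).2 hw, hwj⟩
  have h := (Finset.card_le_card hsub).trans Finset.card_image_le
  rw [Finset.card_map, Finset.card_univ, Fintype.card_fin, card_neighborFinset_eq_degree] at h
  exact Nat.succ_le_succ (h.trans (hG v))

/-! ### Recognizing `K₃,₃`. -/

theorem adj_of_forall_adj_iff {G : SimpleGraph V} {v a b c : V}
    (h : ∀ w, G.Adj v w ↔ w = a ∨ w = b ∨ w = c) : G.Adj v a ∧ G.Adj v b ∧ G.Adj v c :=
  ⟨(h a).2 (by simp), (h b).2 (by simp), (h c).2 (by simp)⟩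

/-- A connected graph in which `u`, `v`, `w` are exactly the neighbors of each of `r`, `s`, `t`,
and conversely, is `K₃,₃`. -/
theorem Connected.nonempty_iso_completeBipartiteGraph_three {G : SimpleGraph V}
    (hconn : G.Connected)
    {u v w r s t : V} (huv : u ≠ v) (huw : u ≠ w) (hvw : v ≠ w)
    (hrs : r ≠ s) (hrt : r ≠ t) (hst : s ≠ t)
    (hu : ∀ x, G.Adj u x ↔ x = r ∨ x = s ∨ x = t) (hv : ∀ x, G.Adj v x ↔ x = r ∨ x = s ∨ x = t)
    (hw : ∀ x, G.Adj w x ↔ x = r ∨ x = s ∨ x = t) (hr : ∀ x, G.Adj r x ↔ x = u ∨ x = v ∨ x = w)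
    (hs : ∀ x, G.Adj s x ↔ x = u ∨ x = v ∨ x = w) (ht : ∀ x, G.Adj t x ↔ x = u ∨ x = v ∨ x = w) :
    Nonempty (G ≃g completeBipartiteGraph (Fin 3) (Fin 3)) := by
  have symm := fun u v => G.adj_comm u v
  have irr := fun u => G.irrefl (v := u)
  have hu_adj := adj_of_forall_adj_iff hu
  have hv_adj := adj_of_forall_adj_iff hv
  have hw_adj := adj_of_forall_adj_iff hw
  have hr_adj := adj_of_forall_adj_iff hr
  have hs_adj := adj_of_forall_adj_iff hs
  have ht_adj := adj_of_forall_adj_iff ht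
  have hall : ∀ x, x = u ∨ x = v ∨ x = w ∨ x = r ∨ x = s ∨ x = t := by
    intro x
    have h := (reachable_iff_reflTransGen u x).1 (hconn.preconnected u x)
    induction h with
    | refl => simp
    | tail _ h ih => rcases ih with rfl | rfl | rfl | rfl | rfl | rfl <;> grind
  have hL : ∀ (i : Fin 3) x, G.Adj (![u, v, w] i) x ↔ ∃ j, x = ![r, s, t] j := fun i x => by
    fin_cases i <;> simp [Fin.exists_fin_succ, hu, hv, hw]
  have hR : ∀ (i : Fin 3) x, G.Adj (![r, s, t] i) x ↔ ∃ j, x = ![u, v, w] j := fun i x => by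
    fin_cases i <;> simp [Fin.exists_fin_succ, hr, hs, ht]
  have hLR : ∀ i j : Fin 3, ![u, v, w] i ≠ ![r, s, t] j := fun i j =>
    ((hL i _).2 ⟨j, rfl⟩).ne
  have hLinj : Function.Injective ![u, v, w] := fun i j h => by
    fin_cases i <;> fin_cases j <;> simp_all
  have hRinj : Function.Injective ![r, s, t] := fun i j h => by
    fin_cases i <;> fin_cases j <;> simp_all
  have hf : Function.Bijective (Sum.elim ![u, v, w] ![r, s, t]) := by
    refine ⟨Function.Injective.sumElim hLinj hRinj hLR, fun x => ?_⟩
    rcases hall x with h | h | h | h | h | h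
    exacts [⟨.inl 0, h.symm⟩, ⟨.inl 1, h.symm⟩, ⟨.inl 2, h.symm⟩, ⟨.inr 0, h.symm⟩,
      ⟨.inr 1, h.symm⟩, ⟨.inr 2, h.symm⟩]
  refine ⟨RelIso.symm ⟨Equiv.ofBijective _ hf, ?_⟩⟩
  rintro (i | i) (j | j)
  · simpa [hL] using hLR j
  · simp [hL, completeBipartiteGraph]
  · simp [hR, completeBipartiteGraph]
  · simpa [hR] using fun k => (hLR k j).symm

/-! ### Neighborhoods in cubic graphs. -/

section Cubic

variable [Fintype V] {G : SimpleGraph V} [DecidableRel G.Adj]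

theorem IsRegularOfDegree.exists_neighbors (hG : G.IsRegularOfDegree 3) (v : V) :
    ∃ a b c, a ≠ b ∧ a ≠ c ∧ b ≠ c ∧ (G.Adj v a ∧ G.Adj v b ∧ G.Adj v c) ∧
      ∀ w, G.Adj v w ↔ w = a ∨ w = b ∨ w = c := by
  classical
  have h := hG v
  rw [← card_neighborFinset_eq_degree, Finset.card_eq_three] at h
  obtain ⟨a, b, c, hab, hac, hbc, h⟩ := h
  have h' : ∀ w, G.Adj v w ↔ w = a ∨ w = b ∨ w = c := fun w => by
    rw [← mem_neighborFinset, h]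
    simp
  exact ⟨a, b, c, hab, hac, hbc, adj_of_forall_adj_iff h', h'⟩

theorem IsRegularOfDegree.exists_neighbors_of_adj (hG : G.IsRegularOfDegree 3) {v a : V}
    (ha : G.Adj v a) :
    ∃ b c, a ≠ b ∧ a ≠ c ∧ b ≠ c ∧ (G.Adj v b ∧ G.Adj v c) ∧
      ∀ w, G.Adj v w ↔ w = a ∨ w = b ∨ w = c := by
  obtain ⟨p, q, r, hpq, hpr, hqr, ⟨hp, hq, hr⟩, h⟩ := hG.exists_neighbors v
  rcases (h a).1 ha with rfl | rfl | rfl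
  · exact ⟨q, r, hpq, hpr, hqr, ⟨hq, hr⟩, h⟩
  · exact ⟨p, r, hpq.symm, hqr, hpr, ⟨hp, hr⟩, fun w => by rw [h]; tauto⟩
  · exact ⟨p, q, hpr.symm, hqr.symm, hpq, ⟨hp, hq⟩, fun w => by rw [h]; tauto⟩

theorem IsRegularOfDegree.exists_neighbor_of_adj (hG : G.IsRegularOfDegree 3) {v a b : V}
    (ha : G.Adj v a) (hb : G.Adj v b) (hab : a ≠ b) :
    ∃ c, a ≠ c ∧ b ≠ c ∧ G.Adj v c ∧ ∀ w, G.Adj v w ↔ w = a ∨ w = b ∨ w = c := by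
  obtain ⟨p, q, hp, hq, hpq, ⟨hvp, hvq⟩, h⟩ := hG.exists_neighbors_of_adj ha
  rcases (h b).1 hb with rfl | rfl | rfl
  · exact absurd rfl hab
  · exact ⟨q, hq, hpq, hvq, h⟩
  · exact ⟨p, hp, hpq.symm, hvp, fun w => by rw [h]; tauto⟩

/-! ### Graphs with a triangle. -/

/-- Two adjacent vertices with the same two further neighbors. -/
theorem exists_isPartialGrundyColoring_of_diamond (hG : G.IsRegularOfDegree 3) {x y z w : V}
    (hxy : G.Adj x y) (hxz : G.Adj x z) (hyz : G.Adj y z) (hxw : G.Adj x w) (hyw : G.Adj y w)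
    (hzw : z ≠ w) : ∃ c : G.Coloring (Fin 4), IsPartialGrundyColoring c := by
  have symm := fun u v => G.adj_comm u v
  have irr := fun u => G.irrefl (v := u)
  obtain hzw' | hzw' := em (G.Adj z w)
  · apply exists_isPartialGrundyColoring_of_sets G hG (A := {w}) (B := {z}) (C := {y}) (D := {x})
      (x := x) (y := y) (z := z) <;> grind
  obtain ⟨z', hz1, hz2, hz_adj, hz⟩ := hG.exists_neighbor_of_adj hxz.symm hyz.symm hxy.ne
  obtain ⟨w', hw1, hw2, hw_adj, hw⟩ := hG.exists_neighbor_of_adj hxw.symm hyw.symm hxy.ne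
  have hx : ∀ v, G.Adj x v ↔ v = y ∨ v = z ∨ v = w := by
    obtain ⟨x', hx1, hx2, hx_adj, hx⟩ := hG.exists_neighbor_of_adj hxy hxz hyz.ne
    grind
  have hy : ∀ v, G.Adj y v ↔ v = x ∨ v = z ∨ v = w := by
    obtain ⟨y', hy1, hy2, hy_adj, hy⟩ := hG.exists_neighbor_of_adj hxy.symm hyz hxz.ne
    grind
  -- If `w' ≠ z'`, then `w'` can share color 0 with `z`, which makes `w` Grundy. If they coincide,
  -- the Grundy vertex of color 1 is instead `t`, the third neighbor of `w'`, with `s` as its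
  -- witness.
  by_cases hzw'' : w' = z'
  · subst hzw''
    obtain ⟨t, ht1, ht2, ht_adj, ht⟩ := hG.exists_neighbor_of_adj (v := w') (a := z) (b := w)
      (by grind) (by grind) hzw
    have htx : t ≠ x ∧ t ≠ y ∧ w' ≠ t := by grind
    obtain ⟨s, r, hs1, hs2, hs3, hs_adj, hs⟩ :=
      hG.exists_neighbors_of_adj (v := t) (a := w') (by grind)
    have hsx : s ≠ x ∧ s ≠ y ∧ s ≠ z ∧ s ≠ w := by grind
    apply exists_isPartialGrundyColoring_of_sets G hG (A := {z, s}) (B := {w, t}) (C := {y})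
      (D := {x}) (x := x) (y := y) (z := t) <;>
      simp only [Set.mem_insert_iff, Set.mem_singleton_iff, forall_eq_or_imp, forall_eq,
        exists_eq_or_imp, exists_eq_left, not_or] <;> (try and_intros) <;> grind
  · apply exists_isPartialGrundyColoring_of_sets G hG (A := {z, w'}) (B := {w}) (C := {y})
      (D := {x}) (x := x) (y := y) (z := w) <;>
      simp only [Set.mem_insert_iff, Set.mem_singleton_iff, forall_eq_or_imp, forall_eq,
        exists_eq_or_imp, exists_eq_left] <;> (try and_intros) <;> grind

/-- A triangle two of whose vertices have distinct and nonadjacent outer neighbors. -/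
theorem exists_isPartialGrundyColoring_of_triangle_of_not_adj (hG : G.IsRegularOfDegree 3)
    {x y z x' y' z' : V}
    (hx : ∀ w, G.Adj x w ↔ w = y ∨ w = z ∨ w = x') (hy : ∀ w, G.Adj y w ↔ w = x ∨ w = z ∨ w = y')
    (hz : ∀ w, G.Adj z w ↔ w = x ∨ w = y ∨ w = z') (hx' : x' ≠ y') (hxz' : x' ≠ z')
    (hyz' : y' ≠ z') (hxx : x' ≠ y ∧ x' ≠ z) (hyy : y' ≠ x ∧ y' ≠ z) (h : ¬ G.Adj x' y') :
    ∃ c : G.Coloring (Fin 4), IsPartialGrundyColoring c := by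
  have symm := fun u v => G.adj_comm u v
  have irr := fun u => G.irrefl (v := u)
  have hx_adj := adj_of_forall_adj_iff hx
  have hy_adj := adj_of_forall_adj_iff hy
  have hz_adj := adj_of_forall_adj_iff hz
  obtain ⟨m, n, hm1, hm2, hmn, hm_adj, hm⟩ :=
    hG.exists_neighbors_of_adj (v := x') (a := x) (by grind)
  -- The witness `m` for `x'` shares color 0 with `z`, so it must avoid `z'`; one of the two
  -- neighbors of `x'` other than `x` does.
  have key : ∃ m, m ≠ z' ∧ m ≠ x ∧ G.Adj x' m := by
    by_cases m = z'
    · exact ⟨n, by grind⟩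
    · exact ⟨m, by grind⟩
  obtain ⟨m, hmz, hmx, hm⟩ := key
  apply exists_isPartialGrundyColoring_of_sets G hG (A := {z, m}) (B := {x', y'}) (C := {y})
    (D := {x}) (x := x) (y := y) (z := x') <;>
    simp only [Set.mem_insert_iff, Set.mem_singleton_iff, forall_eq_or_imp, forall_eq,
      exists_eq_or_imp, exists_eq_left, not_or] <;> (try and_intros) <;> grind

/-- Coinciding outer neighbors give a diamond, and distinct ones with a nonadjacent pair fall under
the preceding lemma. The remaining case is the triangular prism, colored by hand. -/
theorem exists_isPartialGrundyColoring_of_triangle (hG : G.IsRegularOfDegree 3) {x y z : V}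
    (hxy : G.Adj x y) (hxz : G.Adj x z) (hyz : G.Adj y z) :
    ∃ c : G.Coloring (Fin 4), IsPartialGrundyColoring c := by
  have symm := fun u v => G.adj_comm u v
  have irr := fun u => G.irrefl (v := u)
  obtain ⟨x', hx1, hx2, hx_adj, hx⟩ := hG.exists_neighbor_of_adj hxy hxz hyz.ne
  obtain ⟨y', hy1, hy2, hy_adj, hy⟩ := hG.exists_neighbor_of_adj hxy.symm hyz hxz.ne
  obtain ⟨z', hz1, hz2, hz_adj, hz⟩ := hG.exists_neighbor_of_adj hxz.symm hyz.symm hxy.ne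
  by_cases h1 : x' = y'
  · exact exists_isPartialGrundyColoring_of_diamond hG (w := x') hxy hxz hyz
      (by grind) (by grind) (by grind)
  by_cases h2 : x' = z'
  · exact exists_isPartialGrundyColoring_of_diamond hG (w := x') hxz hxy hyz.symm
      (by grind) (by grind) (by grind)
  by_cases h3 : y' = z'
  · exact exists_isPartialGrundyColoring_of_diamond hG (w := y') hyz hxy.symm hxz.symm
      (by grind) (by grind) (by grind)
  by_cases a1 : G.Adj x' y'
  · by_cases a2 : G.Adj x' z'
    · by_cases a3 : G.Adj y' z'
      · apply exists_isPartialGrundyColoring_of_sets G hG (A := {x'}) (B := {z, y'})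
          (C := {y, z'}) (D := {x}) (x := x) (y := z') (z := y') <;>
          simp only [Set.mem_insert_iff, Set.mem_singleton_iff, forall_eq_or_imp, forall_eq,
            exists_eq_or_imp, exists_eq_left, not_or] <;> (try and_intros) <;> grind
      · apply exists_isPartialGrundyColoring_of_triangle_of_not_adj hG (x := y) (y := z) (z := x)
          (x' := y') (y' := z') (z' := x') <;> grind
    · apply exists_isPartialGrundyColoring_of_triangle_of_not_adj hG (x := x) (y := z) (z := y)
        (x' := x') (y' := z') (z' := y') <;> grind
  · apply exists_isPartialGrundyColoring_of_triangle_of_not_adj hG (x := x) (y := y) (z := z)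
      (x' := x') (y' := y') (z' := z') <;> grind

/-! ### Triangle-free graphs with twins. -/

/-- Two vertices `u`, `u'` with the same neighbors `r`, `s`, `t`, where the third neighbor of `r`
is adjacent to neither `s` nor `t`. -/
theorem exists_isPartialGrundyColoring_of_twins_of_not_adj (hG : G.IsRegularOfDegree 3)
    (htri : ∀ x y z, G.Adj x y → G.Adj x z → ¬ G.Adj y z) {u u' r s t r' : V} (huu : u ≠ u')
    (hrs : r ≠ s) (hu : ∀ w, G.Adj u w ↔ w = r ∨ w = s ∨ w = t)
    (hu' : ∀ w, G.Adj u' w ↔ w = r ∨ w = s ∨ w = t) (hr : ∀ w, G.Adj r w ↔ w = u ∨ w = u' ∨ w = r')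
    (hru : r' ≠ u) (hru' : r' ≠ u') (h1 : ¬ G.Adj r' s) (h2 : ¬ G.Adj r' t) :
    ∃ c : G.Coloring (Fin 4), IsPartialGrundyColoring c := by
  have symm := fun u v => G.adj_comm u v
  have irr := fun u => G.irrefl (v := u)
  have hu_adj := adj_of_forall_adj_iff hu
  have hu'_adj := adj_of_forall_adj_iff hu'
  have hr_adj := adj_of_forall_adj_iff hr
  obtain ⟨m, n, hm, hn, hmn, hr'_adj, hr'⟩ :=
    hG.exists_neighbors_of_adj (v := r') (a := r) (by grind)
  obtain ⟨s', hsu, hsu', hs_adj, hs⟩ :=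
    hG.exists_neighbor_of_adj (v := s) (a := u) (b := u') (by grind)
      (by grind) huu
  obtain ⟨t', htu, htu', ht_adj, ht⟩ :=
    hG.exists_neighbor_of_adj (v := t) (a := u) (b := u') (by grind)
      (by grind) huu
  obtain ⟨m1, m2, hm1, hm2, hm12, hm'_adj, hm'⟩ :=
    hG.exists_neighbors_of_adj (v := m) (a := r') (by grind)
  obtain ⟨n1, n2, hn1, hn2, hn12, hn'_adj, hn'⟩ :=
    hG.exists_neighbors_of_adj (v := n) (a := r') (by grind)
  -- Otherwise `m` and `n` are both adjacent to `s`, which then has the four neighbors `u`, `u'`,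
  -- `m`, `n`.
  have key : ∃ z w, G.Adj r' z ∧ G.Adj z w ∧ z ≠ r ∧ w ≠ r' ∧ w ≠ s ∧ w ≠ t := by
    by_contra! hcon
    have e1 := hcon m m1
    have e2 := hcon m m2
    have e3 := hcon n n1
    have e4 := hcon n n2
    grind
  obtain ⟨z, w, k1, k2, k3, k4, k5, k6⟩ := key
  have tr := htri u r s
  have tr1 := htri u s t
  have tr2 := htri u r t
  apply exists_isPartialGrundyColoring_of_sets G hG (A := {u', w}) (B := {u, z})
    (C := {s, r'}) (D := {r}) (x := r) (y := s) (z := z) <;>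
    simp only [Set.mem_insert_iff, Set.mem_singleton_iff, forall_eq_or_imp, forall_eq,
      exists_eq_or_imp, exists_eq_left, not_or] <;> (try and_intros) <;> grind

/-- If the third neighbors of `r`, `s`, `t` all coincide, the graph is `K₃,₃`. Otherwise one of them
differs from the other two, and the preceding lemma applies to it. -/
theorem exists_isPartialGrundyColoring_of_twins (hG : G.IsRegularOfDegree 3)
    (hconn : G.Connected) (hK : IsEmpty (G ≃g completeBipartiteGraph (Fin 3) (Fin 3)))
    (htri : ∀ x y z, G.Adj x y → G.Adj x z → ¬ G.Adj y z) {u v : V} (huv : u ≠ v)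
    (h : ∀ w, G.Adj u w ↔ G.Adj v w) :
    ∃ c : G.Coloring (Fin 4), IsPartialGrundyColoring c := by
  have symm := fun u v => G.adj_comm u v
  have irr := fun u => G.irrefl (v := u)
  obtain ⟨r, s, t, hrs, hrt, hst, hu_adj, hu⟩ := hG.exists_neighbors u
  have hv : ∀ w, G.Adj v w ↔ w = r ∨ w = s ∨ w = t := fun w => (h w).symm.trans (hu w)
  obtain ⟨r', hr1, hr2, hr_adj, hr⟩ :=
    hG.exists_neighbor_of_adj (v := r) (a := u) (b := v) (by grind)
      (by grind) huv
  obtain ⟨s', hs1, hs2, hs_adj, hs⟩ :=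
    hG.exists_neighbor_of_adj (v := s) (a := u) (b := v) (by grind)
      (by grind) huv
  obtain ⟨t', ht1, ht2, ht_adj, ht⟩ :=
    hG.exists_neighbor_of_adj (v := t) (a := u) (b := v) (by grind)
      (by grind) huv
  by_cases e1 : r' = s'
  · by_cases e2 : r' = t'
    · subst e1 e2
      obtain ⟨w, hw1, hw2, hw_adj, hw⟩ :=
        hG.exists_neighbor_of_adj (v := r') (a := r) (b := s) (by grind)
          (by grind) hrs
      obtain ⟨i⟩ := hconn.nonempty_iso_completeBipartiteGraph_three (u := u) (v := v) (w := r')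
        (r := r) (s := s) (t := t) huv hr1 hr2 hrs hrt hst hu hv (by grind) hr hs ht
      exact hK.elim i
    · apply exists_isPartialGrundyColoring_of_twins_of_not_adj hG htri (u := u) (u' := v)
        (r := t) (s := s) (t := r) (r' := t') <;> grind
  · by_cases e2 : r' = t'
    · apply exists_isPartialGrundyColoring_of_twins_of_not_adj hG htri (u := u) (u' := v)
        (r := s) (s := r) (t := t) (r' := s') <;> grind
    · apply exists_isPartialGrundyColoring_of_twins_of_not_adj hG htri (u := u) (u' := v)
        (r := r) (s := s) (t := t) (r' := r') <;> grind

/-! ### Triangle-free graphs without twins. -/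

/-- Let `x`, `y` be adjacent with further neighbors `a`, `b` and `p`, `q`, where `a`, `p` and `b`, `q`
are nonadjacent. Unless there is a partial Grundy coloring with four colors, every neighbor of `b`
other than `x` is adjacent to `p` and not to `a`. -/
theorem exists_isPartialGrundyColoring_or_adj (hG : G.IsRegularOfDegree 3)
    (htri : ∀ x y z, G.Adj x y → G.Adj x z → ¬ G.Adj y z)
    (htwin : ∀ u v, (∀ w, G.Adj u w ↔ G.Adj v w) → u = v) {x y a b p q : V}
    (hab : a ≠ b) (hya : y ≠ a) (hyb : y ≠ b) (hpq : p ≠ q) (hxp : x ≠ p) (hxq : x ≠ q)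
    (hx : ∀ w, G.Adj x w ↔ w = y ∨ w = a ∨ w = b) (hy : ∀ w, G.Adj y w ↔ w = x ∨ w = p ∨ w = q)
    (hap : ¬ G.Adj a p) (hbq : ¬ G.Adj b q) :
    (∃ c : G.Coloring (Fin 4), IsPartialGrundyColoring c) ∨
      ∀ w, G.Adj b w → w ≠ x → G.Adj w p ∧ ¬ G.Adj w a := by
  have symm := fun u v => G.adj_comm u v
  have irr := fun u => G.irrefl (v := u)
  have hx_adj := adj_of_forall_adj_iff hx
  have hy_adj := adj_of_forall_adj_iff hy
  rw [or_iff_not_imp_left]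
  intro hcon w hw hwx
  obtain ⟨w', hw1, hw2, hb_adj, hb⟩ :=
    hG.exists_neighbor_of_adj (v := b) (a := x) (b := w) (by grind)
      hw hwx.symm
  have t1 := htri x y a
  have t2 := htri x y b
  have t3 := htri x a b
  have t4 := htri b w x
  have t5 := htri b w w'
  have t6 := htri y p q
  -- If `w` is adjacent to `a`, then `w'` is not, since `a` and `b` are not twins. So `w'` may share
  -- color 0 with `a`, and `w`, which sees both `a` and `b`, is the Grundy vertex of color 2.
  have h1 : ¬ G.Adj w a := by
    intro hwa
    have h2 : ¬ G.Adj w' a := by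
      intro h
      refine hab (htwin a b ?_)
      obtain ⟨e, he1, he2, he_adj, he⟩ :=
        hG.exists_neighbor_of_adj (v := a) (a := x) (b := w) (by grind)
          (by grind) hwx.symm
      grind
    refine hcon ?_
    apply exists_isPartialGrundyColoring_of_sets G hG (A := {a, w'}) (B := {b})
      (C := {y, w}) (D := {x}) (x := x) (y := w) (z := b) <;>
      simp only [Set.mem_insert_iff, Set.mem_singleton_iff, forall_eq_or_imp, forall_eq,
        exists_eq_or_imp, exists_eq_left, not_or] <;> (try and_intros) <;> grind
  refine ⟨?_, h1⟩
  -- Now `w` is adjacent to neither `a` nor `p`, so it can join them in color 0 and make `b` Grundy.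
  by_contra h2
  refine hcon ?_
  apply exists_isPartialGrundyColoring_of_sets G hG (A := {a, p, w}) (B := {b, q})
    (C := {y}) (D := {x}) (x := x) (y := y) (z := b) <;>
    simp only [Set.mem_insert_iff, Set.mem_singleton_iff, forall_eq_or_imp, forall_eq,
      exists_eq_or_imp, exists_eq_left, not_or] <;> (try and_intros) <;> grind

/-- Applying the preceding lemma to the edge in both directions determines the neighborhoods of `a`
and `p` when no coloring has been found. It follows that `a`, `q` and `b`, `p` are also nonadjacent,
so the roles of `p` and `q` can be exchanged; now `b₁` may share color 0 with `a` and `q`. -/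
theorem exists_isPartialGrundyColoring_of_not_adj (hG : G.IsRegularOfDegree 3)
    (htri : ∀ x y z, G.Adj x y → G.Adj x z → ¬ G.Adj y z)
    (htwin : ∀ u v, (∀ w, G.Adj u w ↔ G.Adj v w) → u = v) {x y a b p q : V}
    (hab : a ≠ b) (hya : y ≠ a) (hyb : y ≠ b) (hpq : p ≠ q) (hxp : x ≠ p) (hxq : x ≠ q)
    (hx : ∀ w, G.Adj x w ↔ w = y ∨ w = a ∨ w = b) (hy : ∀ w, G.Adj y w ↔ w = x ∨ w = p ∨ w = q)
    (hap : ¬ G.Adj a p) (hbq : ¬ G.Adj b q) :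
    ∃ c : G.Coloring (Fin 4), IsPartialGrundyColoring c := by
  have symm := fun u v => G.adj_comm u v
  have irr := fun u => G.irrefl (v := u)
  have hx_adj := adj_of_forall_adj_iff hx
  have hy_adj := adj_of_forall_adj_iff hy
  rcases exists_isPartialGrundyColoring_or_adj hG htri htwin hab hya hyb hpq hxp hxq hx hy hap hbq
    with h | h1
  · exact h
  rcases exists_isPartialGrundyColoring_or_adj hG htri htwin hpq hxp hxq hab hya hyb hy hx
    (fun h => hap h.symm) (fun h => hbq h.symm) with h | h2
  · exact h
  obtain ⟨b₁, b₂, hb1, hb2, hb12, hb_adj, hb⟩ :=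
    hG.exists_neighbors_of_adj (v := b) (a := x) (by grind)
  obtain ⟨q₁, q₂, hq1, hq2, hq12, hq_adj, hq⟩ :=
    hG.exists_neighbors_of_adj (v := q) (a := y) (by grind)
  have hp1 := h1 b₁ (by grind) (by grind)
  have hp2 := h1 b₂ (by grind) (by grind)
  have ha1 := h2 q₁ (by grind) (by grind)
  have ha2 := h2 q₂ (by grind) (by grind)
  have t1 := htri x y a
  have t2 := htri x y b
  have t3 := htri x a b
  have t4 := htri y x p
  have t5 := htri y x q
  have t6 := htri y p q
  have hby : b₁ ≠ y ∧ b₂ ≠ y := by grind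
  have hqx : q₁ ≠ x ∧ q₂ ≠ x := by grind
  obtain ⟨p₃, -, -, hp_adj, hp⟩ := hG.exists_neighbor_of_adj hp1.1.symm hp2.1.symm hb12
  obtain ⟨a₃, -, -, ha_adj, ha⟩ := hG.exists_neighbor_of_adj ha1.1.symm ha2.1.symm hq12
  have haq : ¬ G.Adj a q := by grind
  have hbp : ¬ G.Adj b p := by grind
  have hbq₁ : ¬ G.Adj b₁ q := by grind
  apply exists_isPartialGrundyColoring_of_sets G hG (A := {a, q, b₁}) (B := {b, p})
    (C := {y}) (D := {x}) (x := x) (y := y) (z := b) <;>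
    simp only [Set.mem_insert_iff, Set.mem_singleton_iff, forall_eq_or_imp, forall_eq,
      exists_eq_or_imp, exists_eq_left, not_or] <;> (try and_intros) <;> grind

theorem exists_isPartialGrundyColoring_four (hG : G.IsRegularOfDegree 3)
    (hconn : G.Connected) (hK : IsEmpty (G ≃g completeBipartiteGraph (Fin 3) (Fin 3))) :
    ∃ c : G.Coloring (Fin 4), IsPartialGrundyColoring c := by
  have symm := fun u v => G.adj_comm u v
  have irr := fun u => G.irrefl (v := u)
  by_cases htri : ∀ x y z, G.Adj x y → G.Adj x z → ¬ G.Adj y z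
  swap
  · push Not at htri
    obtain ⟨x, y, z, hxy, hxz, hyz⟩ := htri
    exact exists_isPartialGrundyColoring_of_triangle hG hxy hxz hyz
  by_cases htwin : ∀ u v, (∀ w, G.Adj u w ↔ G.Adj v w) → u = v
  swap
  · push Not at htwin
    obtain ⟨u, v, h, huv⟩ := htwin
    exact exists_isPartialGrundyColoring_of_twins hG hconn hK htri huv h
  obtain ⟨x⟩ := hconn.nonempty
  obtain ⟨y, a, b, hya, hyb, hab, hx_adj, hx⟩ := hG.exists_neighbors x
  obtain ⟨p, q, hxp, hxq, hpq, hy_adj, hy⟩ :=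
    hG.exists_neighbors_of_adj (v := y) (a := x) (by grind)
  by_cases h1 : ¬ G.Adj a p ∧ ¬ G.Adj b q
  · exact exists_isPartialGrundyColoring_of_not_adj hG htri htwin hab hya hyb hpq hxp hxq hx hy
      h1.1 h1.2
  by_cases h2 : ¬ G.Adj a q ∧ ¬ G.Adj b p
  · exact exists_isPartialGrundyColoring_of_not_adj hG htri htwin hab hya hyb hpq.symm hxq hxp hx
      (by grind) h2.1 h2.2
  obtain ⟨a₁, a₂, ha1, ha2, ha3, ha_adj, ha⟩ :=
    hG.exists_neighbors_of_adj (v := a) (a := x) (by grind)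
  obtain ⟨b₁, b₂, hb1, hb2, hb3, hb_adj, hb⟩ :=
    hG.exists_neighbors_of_adj (v := b) (a := x) (by grind)
  obtain ⟨p₁, p₂, hp1, hp2, hp3, hp_adj, hp⟩ :=
    hG.exists_neighbors_of_adj (v := p) (a := y) (by grind)
  obtain ⟨q₁, q₂, hq1, hq2, hq3, hq_adj, hq⟩ :=
    hG.exists_neighbors_of_adj (v := q) (a := y) (by grind)
  -- As neither pairing of `a`, `b` with `p`, `q` consists of nonadjacent pairs, one of these four
  -- vertices is adjacent to both on the other side, hence is a twin of `x` or `y`.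
  have h3 : (G.Adj a p ∧ G.Adj a q) ∨ (G.Adj b p ∧ G.Adj b q) ∨ (G.Adj a p ∧ G.Adj b p) ∨
      (G.Adj a q ∧ G.Adj b q) := by tauto
  rcases h3 with h | h | h | h
  · refine absurd (htwin y a ?_) hya
    clear hb hp hq h1 h2 htri htwin
    grind
  · refine absurd (htwin y b ?_) hyb
    clear ha hp hq h1 h2 htri htwin
    grind
  · refine absurd (htwin x p ?_) hxp
    clear ha hb hq h1 h2 htri htwin
    grind
  · refine absurd (htwin x q ?_) hxq
    clear ha hb hp h1 h2 htri htwin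
    grind

end Cubic

end SimpleGraph

theorem mainTheorem5 {V : Type*} [Fintype V] (G : SimpleGraph V) [DecidableRel G.Adj]
    (hconn : G.Connected) (hcubic : G.IsRegularOfDegree 3)
    (hK : IsEmpty (G ≃g completeBipartiteGraph (Fin 3) (Fin 3))) :
    G.partialGrundyNumber = 4 :=
  IsGreatest.csSup_eq ⟨SimpleGraph.exists_isPartialGrundyColoring_four hcubic hconn hK,
    fun _ ⟨_, hc⟩ => hc.le_succ_degree fun v => (hcubic v).le⟩
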